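/- Let $N\ge 2$, $s\ge 3$, and let $K_1,\dots,K_s\subset\mathbb{R}^N$ be non-empty, pairwise disjoint, compact, strictly convex sets with $C^2$-smooth boundaries such that for all $i,j,k$ with $i\ne k\ne j$ the convex hull of $K_i\cup K_j$ does not meet $K_k$ (an open billiard). Put $K=K_1\cup\dots\cup K_s$. The billiard particle moves in $\mathbb{R}^N\setminus K$: from a point $x\in\partial K$ with outgoing unit direction $v$ (that is, $\langle\nu(x),v\rangle>0$, where $\nu$ is the unit normal to $\partial K$ pointing out of $K$) it travels along the ray $x+tv$, $t>0$, to the first point $y\in\partial K$ of this ray, and leaves $y$ in the direction $v-2\langle v,\nu(y)\rangle\nu(y)$, which is again required to be outgoing. Let $\Sigma$ be the set of all bi-infinite sequences $\xi=(\xi_i)_{i\in\mathbb{Z}}$ in $\{1,\dots,s\}$ with $\xi_i\ne\xi_{i+1}$ for all $i$, and let $\sigma$ be the left shift, $(\sigma\xi)_i=\xi_{i+1}$. Then for every $\xi\in\Sigma$ there is a unique pair $(y,v)$ of a point $y\in\partial K$ and an outgoing unit vector $v$ such that the billiard trajectory through $(y,v)$ is defined for all integer times, backwards and forwards, and its $i$-th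 reflection occurs on $\partial K_{\xi_i}$ for every $i\in\mathbb{Z}$ (the $0$-th one at $y$). Define $\phi:\Sigma\to\mathbb{R}^N$ by $\phi(\xi)=y$. Let $$\rho_\phi(\xi)=\lim_{n\to\infty}\frac1n\sum_{i=0}^{n-1}\phi(\sigma^i\xi)$$ whenever the limit exists, let $J_\phi$ (the pointwise rotation set) be the set of all $\rho_\phi(\xi)$, over the $\xi\in\Sigma$ for which the limit exists, and let $P_\phi$ be the set of all finite convex combinations of vectors $\rho_\phi(\xi)$ with $\xi\in\Sigma$ periodic (that is, $\sigma^n\xi=\xi$ for some $n\ge1$). Then the closure of $J_\phi$ is convex, and $P_\phi$ is dense in $J_\phi$, that is, $P_\phi\subseteq J_\phi\subseteq\overline{P_\phi}$. -/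

import Mathlib

open Set Filter Topology

noncomputable section

/-- Near `x`, the set `A` is the sublevel set `{f ≤ 0}` of a function `f` that is `C²` at `x`
(hence on a neighbourhood of `x`) and has non-zero gradient at `x`. -/
structure IsDefiningFunctionAt {N : ℕ} (A : Set (EuclideanSpace ℝ (Fin N)))
    (x : EuclideanSpace ℝ (Fin N)) (f : EuclideanSpace ℝ (Fin N) → ℝ) : Prop where
  contDiffAt : ContDiffAt ℝ 2 f x
  gradient_ne_zero : gradient f x ≠ 0
  eventually_mem_iff : ∀ᶠ y in 𝓝 x, y ∈ A ↔ f y ≤ 0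

/-- The boundary of `A` is a `C²` hypersurface, with `A` locally on one side of it. -/
def HasC2Boundary {N : ℕ} (A : Set (EuclideanSpace ℝ (Fin N))) : Prop :=
  ∀ x ∈ frontier A, ∃ f : EuclideanSpace ℝ (Fin N) → ℝ, IsDefiningFunctionAt A x f

/-- `ν` is the unit normal to the boundary of `A` at `x` that points out of `A`, that is, into the
billiard domain when `A` is the union of the obstacles. -/
def IsOuterUnitNormal {N : ℕ} (A : Set (EuclideanSpace ℝ (Fin N)))
    (x ν : EuclideanSpace ℝ (Fin N)) : Prop :=
  x ∈ frontier A ∧ ∃ f : EuclideanSpace ℝ (Fin N) → ℝ,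
    IsDefiningFunctionAt A x f ∧ ν = ‖gradient f x‖⁻¹ • gradient f x

/-- Open billiards: at least three pairwise disjoint compact strictly convex obstacles with `C²`
boundary in a Euclidean space of dimension at least two, no one of which meets the convex hull of
the union of two others. The billiard domain is the complement of `⋃ i, K i`. -/
structure IsOpenBilliard {N s : ℕ} (K : Fin s → Set (EuclideanSpace ℝ (Fin N))) : Prop where
  two_le_dim : 2 ≤ N
  three_le_card : 3 ≤ s
  nonempty : ∀ i, (K i).Nonempty
  isCompact : ∀ i, IsCompact (K i)
  strictConvex : ∀ i, StrictConvex ℝ (K i)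
  hasC2Boundary : ∀ i, HasC2Boundary (K i)
  pairwise_disjoint : Pairwise fun i j => Disjoint (K i) (K j)
  no_eclipse : ∀ i j k, i ≠ k → k ≠ j → Disjoint (convexHull ℝ (K i ∪ K j)) (K k)

/-- The phase space in the exterior of `A`: pairs of a boundary point `x` and a unit vector `v`
with `⟨ν(x), v⟩ > 0`. -/
def phaseSpace {N : ℕ} (A : Set (EuclideanSpace ℝ (Fin N))) :
    Set (EuclideanSpace ℝ (Fin N) × EuclideanSpace ℝ (Fin N)) :=
  {q | q.1 ∈ frontier A ∧ ‖q.2‖ = 1 ∧ ∃ ν, IsOuterUnitNormal A q.1 ν ∧ 0 < inner ℝ ν q.2}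

/-- The graph of the billiard ball map in the exterior of `A`: from `q = (x, v)` the particle moves
along the ray issued from `x` in direction `v`, hits the boundary for the first time at `y`, and is
reflected there by the law of reflection, which gives `q' = (y, v - 2 ⟨v, ν(y)⟩ ν(y))`. -/
structure IsBilliardStep {N : ℕ} (A : Set (EuclideanSpace ℝ (Fin N)))
    (q q' : EuclideanSpace ℝ (Fin N) × EuclideanSpace ℝ (Fin N)) : Prop where
  source_mem : q ∈ phaseSpace A
  target_mem : q' ∈ phaseSpace A
  on_ray : ∃ t : ℝ, 0 < t ∧ q'.1 = q.1 + t • q.2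
  first_hit : Disjoint (openSegment ℝ q.1 q'.1) (frontier A)
  reflection : ∃ ν, IsOuterUnitNormal A q'.1 ν ∧ q'.2 = q.2 - (2 * inner ℝ q.2 ν) • ν

/-- The space of admissible bi-infinite sequences: consecutive symbols are different. -/
def SymbolSpace (s : ℕ) : Type := {ξ : ℤ → Fin s // ∀ i, ξ i ≠ ξ (i + 1)}

/-- The left shift. -/
def shift {s : ℕ} (ξ : SymbolSpace s) : SymbolSpace s :=
  ⟨fun i => ξ.1 (i + 1), fun i => ξ.2 (i + 1)⟩

/-- The billiard trajectory through the phase point `q` is defined for all times in `ℤ`, and its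
`i`-th reflection occurs at the boundary of the obstacle `K (ξ i)`, for every integer `i`. -/
def HasItinerary {N s : ℕ} (K : Fin s → Set (EuclideanSpace ℝ (Fin N))) (ξ : SymbolSpace s)
    (q : EuclideanSpace ℝ (Fin N) × EuclideanSpace ℝ (Fin N)) : Prop :=
  ∃ γ : ℤ → EuclideanSpace ℝ (Fin N) × EuclideanSpace ℝ (Fin N), γ 0 = q ∧
    (∀ i, IsBilliardStep (⋃ k, K k) (γ i) (γ (i + 1))) ∧ ∀ i, (γ i).1 ∈ frontier (K (ξ.1 i))

open Classical in
/-- The starting-point observable: the base point of the phase point with itinerary `ξ`. -/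
def startingPoint {N s : ℕ} (K : Fin s → Set (EuclideanSpace ℝ (Fin N))) (ξ : SymbolSpace s) :
    EuclideanSpace ℝ (Fin N) :=
  if h : ∃ q, HasItinerary K ξ q then h.choose.1 else 0

/-- `ρ` is the rotation vector of `ξ` for the observable `φ`, that is, the limit of
`(1 / n) ∑_{i < n} φ (σ^i ξ)`. -/
def IsRotationVector {N s : ℕ} (φ : SymbolSpace s → EuclideanSpace ℝ (Fin N))
    (ξ : SymbolSpace s) (ρ : EuclideanSpace ℝ (Fin N)) : Prop :=
  Tendsto (fun n : ℕ => birkhoffAverage ℝ shift φ n ξ) atTop (𝓝 ρ)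

/-- The pointwise rotation set `J_φ`. -/
def pointwiseRotationSet {N s : ℕ} (φ : SymbolSpace s → EuclideanSpace ℝ (Fin N)) :
    Set (EuclideanSpace ℝ (Fin N)) :=
  {ρ | ∃ ξ, IsRotationVector φ ξ ρ}

/-- The set `P_φ` of all (finite) convex combinations of rotation vectors of periodic
trajectories. -/
def periodicRotationHull {N s : ℕ} (φ : SymbolSpace s → EuclideanSpace ℝ (Fin N)) :
    Set (EuclideanSpace ℝ (Fin N)) :=
  convexHull ℝ {ρ | ∃ ξ ∈ Function.periodicPts (shift (s := s)), IsRotationVector φ ξ ρ}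

end

/-!
Billiard trajectories are described variationally. A sequence of points `q i ∈ K (ξ i)` is the
sequence of reflection points of a trajectory with itinerary `ξ` if and only if each `q i`
minimizes the length of the broken line from `q (i - 1)` to `q (i + 1)` over `K (ξ i)`
(`IsTrajectory`): at a minimum the change of velocity `kick` satisfies `⟪kick, y - q i⟫ ≤ 0` on
`K (ξ i)`, so, being non-zero since no obstacle eclipses another, it is a positive multiple of the
outer normal, which is the law of reflection; the converse is the convexity of the length. The
condition is closed, so trajectories exist by minimizing lengths of finite broken lines and passing
to the limit (`IsOpenBilliard.exists_isTrajectory`).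

Uniqueness and continuity come from a monotone quantity. For two trajectories with velocities `v`,
`v'`, the number `a i = ⟪v' i - v i, q' i - q i⟫` does not decrease during free flight, because the
gradient of the norm is monotone, and at each reflection it increases by an amount that is bounded
below in terms of `‖q' i - q i‖`, by strict convexity and compactness. As `a` is bounded, the two
trajectories come close to each other before and after time `0`, where `a` is small, and hence they
are close at time `0` as well (`IsOpenBilliard.exists_norm_sub_lt`). No curvature bound is needed.

So the observable is bounded and uniformly continuous on the space of itineraries, and the rest is
symbolic. The Birkhoff sums of two sequences that share a word of length `n` differ by `o(n)`.
Repeating a long initial word of `ξ`, closed up by one more symbol, therefore approximates the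
rotation vector of `ξ` by periodic ones (`IsUniformlyLocal.pointwiseRotationSet_subset`). Conversely
the pointwise rotation set itself is convex (`IsUniformlyLocal.convex_pointwiseRotationSet`):
given a point `ρ` of the segment between two rotation vectors, follow one of the two sequences
during `[l ^ 2, (l + 1) ^ 2)`, where the choice is made so that the new contribution to the
discrepancy from `ρ` forms no acute angle with the old discrepancy; the discrepancy at time `n` is
then `o(n)`.
A third symbol makes the junctions of words admissible, and this is where `3 ≤ s` enters.
-/

/-! ### Length minimizing broken lines and reflection -/

section Reflection

variable {E : Type*} [NormedAddCommGroup E] [InnerProductSpace ℝ E]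

/-- The unit vector pointing from `a` to `b` (and `0` if `a = b`). -/
noncomputable def unitDir (a b : E) : E := ‖b - a‖⁻¹ • (b - a)

theorem norm_unitDir {a b : E} (h : a ≠ b) : ‖unitDir a b‖ = 1 := by
  have : ‖b - a‖ ≠ 0 := norm_ne_zero_iff.2 (sub_ne_zero.2 h.symm)
  rw [unitDir, norm_smul, norm_inv, norm_norm, inv_mul_cancel₀ this]

theorem norm_unitDir_le (a b : E) : ‖unitDir a b‖ ≤ 1 := by
  by_cases h : a = b
  · simp [unitDir, h]
  · exact (norm_unitDir h).le

theorem norm_smul_unitDir (a b : E) : ‖b - a‖ • unitDir a b = b - a := by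
  by_cases h : a = b
  · simp [unitDir, h]
  · have : ‖b - a‖ ≠ 0 := norm_ne_zero_iff.2 (sub_ne_zero.2 (Ne.symm h))
    rw [unitDir, smul_smul, mul_inv_cancel₀ this, one_smul]

theorem inner_unitDir_le (a b x : E) : inner ℝ (unitDir a b) x ≤ ‖x‖ :=
  (real_inner_le_norm _ _).trans
    (mul_le_of_le_one_left (norm_nonneg _) (norm_unitDir_le a b))

theorem inner_unitDir_sub (a b : E) : inner ℝ (unitDir a b) (b - a) = ‖b - a‖ := by
  by_cases h : a = b
  · simp [unitDir, h]
  · have : ‖b - a‖ ≠ 0 := norm_ne_zero_iff.2 (sub_ne_zero.2 (Ne.symm h))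
    rw [unitDir, real_inner_smul_left, real_inner_self_eq_norm_sq]
    field_simp

/-- Monotonicity of the gradient of the norm. -/
theorem inner_unitDir_sub_unitDir_nonneg (a b a' b' : E) :
    0 ≤ inner ℝ (unitDir a' b' - unitDir a b) ((b' - a') - (b - a)) := by
  have h1 := inner_unitDir_le a' b' (b - a)
  have h2 := inner_unitDir_le a b (b' - a')
  have h3 := inner_unitDir_sub a b
  have h4 := inner_unitDir_sub a' b'
  rw [inner_sub_left, inner_sub_right _ (b' - a'), inner_sub_right _ (b' - a')]
  linarith

theorem ContinuousOn.unitDir {X : Type*} [TopologicalSpace X] {S : Set X} {f g : X → E}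
    (hf : ContinuousOn f S) (hg : ContinuousOn g S) (h : ∀ x ∈ S, f x ≠ g x) :
    ContinuousOn (fun x => unitDir (f x) (g x)) S := by
  have : ContinuousOn (fun x => g x - f x) S := hg.sub hf
  exact (this.norm.inv₀ fun x hx => norm_ne_zero_iff.2 (sub_ne_zero.2 (h x hx).symm)).smul this

/-- The change of velocity at `q` of a unit speed particle moving from `p` to `q` to `r`. -/
noncomputable def kick (p q r : E) : E := unitDir q r - unitDir p q

theorem kick_ne_zero {p q r : E} (h : q ∉ segment ℝ p r) : kick p q r ≠ 0 := by
  intro h0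
  refine h (mem_segment_iff_sameRay.2 (sameRay_iff_inv_norm_smul_eq.2 (Or.inr (Or.inr ?_))))
  exact (sub_eq_zero.1 h0).symm

theorem inner_kick_unitDir_right {p q r : E} (hpq : p ≠ q) (hqr : q ≠ r) :
    inner ℝ (kick p q r) (unitDir q r) = ‖kick p q r‖ ^ 2 / 2 := by
  have h : ‖kick p q r‖ ^ 2 = _ := norm_sub_sq_real (unitDir q r) (unitDir p q)
  rw [norm_unitDir hpq, norm_unitDir hqr] at h
  rw [h, kick, inner_sub_left, real_inner_self_eq_norm_sq, norm_unitDir hqr,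
    real_inner_comm (unitDir q r)]
  ring

theorem inner_kick_unitDir_left {p q r : E} (hpq : p ≠ q) (hqr : q ≠ r) :
    inner ℝ (kick p q r) (unitDir p q) = -(‖kick p q r‖ ^ 2 / 2) := by
  have h : ‖kick p q r‖ ^ 2 = _ := norm_sub_sq_real (unitDir q r) (unitDir p q)
  rw [norm_unitDir hpq, norm_unitDir hqr] at h
  rw [h, kick, inner_sub_left, real_inner_self_eq_norm_sq, norm_unitDir hpq]
  ring

/-- The point `q` of `L` minimizes over `L` the length of the broken line from `p` to `r`. For a
convex body `L` this is the law of reflection at `q`, in a form that is visibly closed in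
`(p, q, r)`. -/
def IsLengthMin (L : Set E) (p q r : E) : Prop :=
  q ∈ L ∧ ∀ y ∈ L, ‖q - p‖ + ‖r - q‖ ≤ ‖y - p‖ + ‖r - y‖

theorem isLengthMin_of_inner_kick_nonpos {L : Set E} {p q r : E} (hq : q ∈ L)
    (h : ∀ y ∈ L, inner ℝ (kick p q r) (y - q) ≤ 0) : IsLengthMin L p q r := by
  refine ⟨hq, fun y hy => ?_⟩
  have h0 := h y hy
  have h1 := inner_unitDir_le p q (y - p)
  have h2 := inner_unitDir_le q r (r - y)
  have h3 := inner_unitDir_sub p q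
  have h4 := inner_unitDir_sub q r
  rw [kick, inner_sub_left] at h0
  have e1 : y - p = (y - q) + (q - p) := by abel
  have e2 : r - y = (r - q) - (y - q) := by abel
  rw [e1, inner_add_right, ← e1] at h1
  rw [e2, inner_sub_right, ← e2] at h2
  linarith

theorem IsLengthMin.inner_kick_nonpos {L : Set E} (hL : Convex ℝ L) {p q r : E}
    (h : IsLengthMin L p q r) (hp : p ∉ L) (hr : r ∉ L) {y : E} (hy : y ∈ L) :
    inner ℝ (kick p q r) (y - q) ≤ 0 := by
  have hmem : ∀ t ∈ Icc (0 : ℝ) 1, q + t • (y - q) ∈ L := fun t ht =>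
    hL.add_smul_sub_mem h.1 hy ht
  have hpos : ∀ t ∈ Ioc (0 : ℝ) 1,
      inner ℝ (kick p (q + t • (y - q)) r) (y - q) ≤ 0 := by
    intro t ht
    set z := q + t • (y - q) with hz
    have h0 := h.2 z (hmem t ⟨ht.1.le, ht.2⟩)
    have h1 := inner_unitDir_le p z (q - p)
    have h2 := inner_unitDir_le z r (r - q)
    have h3 := inner_unitDir_sub p z
    have h4 := inner_unitDir_sub z r
    have e1 : q - p = (z - p) - t • (y - q) := by rw [hz]; abel
    have e2 : r - q = (r - z) + t • (y - q) := by rw [hz]; abel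
    rw [e1, inner_sub_right, real_inner_smul_right, ← e1] at h1
    rw [e2, inner_add_right, real_inner_smul_right, ← e2] at h2
    have : t * inner ℝ (kick p z r) (y - q) ≤ 0 := by
      rw [kick, inner_sub_left]; nlinarith
    exact nonpos_of_mul_nonpos_right this ht.1
  have hc : ContinuousOn (fun t : ℝ => inner ℝ (kick p (q + t • (y - q)) r) (y - q))
      (Icc 0 1) := by
    have hz : ContinuousOn (fun t : ℝ => q + t • (y - q)) (Icc 0 1) := by fun_prop
    refine ContinuousOn.inner ((hz.unitDir continuousOn_const ?_).sub
      (continuousOn_const.unitDir hz ?_)) continuousOn_const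
    · exact fun t ht e => hr (e ▸ hmem t ht)
    · exact fun t ht e => hp (e.symm ▸ hmem t ht)
  have hc0 := (hc 0 ⟨le_rfl, zero_le_one⟩).mono Ioc_subset_Icc_self
  have : (𝓝[Ioc (0 : ℝ) 1] 0).NeBot := by
    rw [nhdsWithin_Ioc_eq_nhdsGT zero_lt_one]; infer_instance
  have := le_of_tendsto hc0.tendsto (eventually_mem_nhdsWithin.mono hpos)
  simpa using this

/-- A non-zero outward normal to a strictly convex set at one of its points is negative on the
displacements to all other points. -/
theorem inner_neg_of_strictConvex {L : Set E} (hL : StrictConvex ℝ L) {q w : E} (hq : q ∈ L)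
    (hw : w ≠ 0) (h : ∀ y ∈ L, inner ℝ w (y - q) ≤ 0) {y : E} (hy : y ∈ L) (hne : y ≠ q) :
    inner ℝ w (y - q) < 0 := by
  have hm : (1 / 2 : ℝ) • y + (1 / 2 : ℝ) • q ∈ interior L :=
    hL hy hq hne (by norm_num) (by norm_num) (by norm_num)
  set m := (1 / 2 : ℝ) • y + (1 / 2 : ℝ) • q with hmdef
  have hc : Tendsto (fun t : ℝ => m + t • w) (𝓝[>] 0) (𝓝 m) := by
    have : Continuous fun t : ℝ => m + t • w := by fun_prop
    simpa using (this.tendsto 0).mono_left nhdsWithin_le_nhds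
  obtain ⟨t, ht, ht0⟩ :=
    ((hc.eventually (isOpen_interior.mem_nhds hm)).and self_mem_nhdsWithin).exists
  have h1 := h _ (interior_subset ht)
  have e : m + t • w - q = (1 / 2 : ℝ) • (y - q) + t • w := by
    rw [hmdef]; module
  rw [e, inner_add_right, real_inner_smul_right, real_inner_smul_right,
    real_inner_self_eq_norm_sq] at h1
  have : 0 < t * ‖w‖ ^ 2 := mul_pos ht0 (pow_pos (norm_pos_iff.2 hw) 2)
  linarith

theorem mem_frontier_of_inner_nonpos {L : Set E} {q w : E} (hq : q ∈ L) (hw : w ≠ 0)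
    (h : ∀ y ∈ L, inner ℝ w (y - q) ≤ 0) : q ∈ frontier L := by
  refine ⟨subset_closure hq, fun hm => ?_⟩
  have hc : Tendsto (fun t : ℝ => q + t • w) (𝓝[>] 0) (𝓝 q) := by
    have : Continuous fun t : ℝ => q + t • w := by fun_prop
    simpa using (this.tendsto 0).mono_left nhdsWithin_le_nhds
  obtain ⟨t, ht, ht0⟩ :=
    ((hc.eventually (isOpen_interior.mem_nhds hm)).and self_mem_nhdsWithin).exists
  have h1 := h _ (interior_subset ht)
  rw [add_sub_cancel_left, real_inner_smul_right, real_inner_self_eq_norm_sq] at h1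
  have : 0 < t * ‖w‖ ^ 2 := mul_pos ht0 (pow_pos (norm_pos_iff.2 hw) 2)
  linarith

theorem isClosed_setOf_isLengthMin {F X : Type*} [NormedAddCommGroup F] [TopologicalSpace X]
    {L : Set F} (hL : IsClosed L) {p q r : X → F} (hp : Continuous p) (hq : Continuous q)
    (hr : Continuous r) :
    IsClosed {x | IsLengthMin L (p x) (q x) (r x)} := by
  have : {x | IsLengthMin L (p x) (q x) (r x)} = q ⁻¹' L ∩
      ⋂ y, ⋂ _ : y ∈ L, {x | ‖q x - p x‖ + ‖r x - q x‖ ≤ ‖y - p x‖ + ‖r x - y‖} := by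
    ext x
    simp [IsLengthMin]
  rw [this]
  refine (hL.preimage hq).inter ?_
  refine isClosed_iInter fun y => isClosed_iInter fun _ => ?_
  exact isClosed_le (by fun_prop) (by fun_prop)

/-- By compactness, two reflections on the same strictly convex body at points at distance at
least `ε` have impulses that are uniformly transverse to the displacement. -/
theorem exists_le_inner_kick_sub_kick {A B C : Set E} (hA : IsCompact A) (hB : IsCompact B)
    (hC : IsCompact C) (hconv : StrictConvex ℝ B) (hAB : Disjoint A B) (hBC : Disjoint B C)
    (hseg : ∀ p ∈ A, ∀ q ∈ B, ∀ r ∈ C, q ∉ segment ℝ p r) {ε : ℝ} (hε : 0 < ε) :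
    ∃ δ > 0, ∀ p ∈ A, ∀ r ∈ C, ∀ p' ∈ A, ∀ r' ∈ C, ∀ q q', IsLengthMin B p q r →
      IsLengthMin B p' q' r' → ε ≤ ‖q' - q‖ →
        δ ≤ inner ℝ (kick p' q' r' - kick p q r) (q' - q) := by
  have hAne : ∀ {p q}, p ∈ A → q ∈ B → p ≠ q := fun hp hq e =>
    disjoint_left.1 hAB hp (e ▸ hq)
  have hCne : ∀ {q r}, q ∈ B → r ∈ C → q ≠ r := fun hq hr e =>
    disjoint_left.1 hBC hq (e ▸ hr)
  let S : Set ((E × E × E) × (E × E × E)) := (A ×ˢ B ×ˢ C) ×ˢ (A ×ˢ B ×ˢ C)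
  have hS : IsCompact S := (hA.prod (hB.prod hC)).prod (hA.prod (hB.prod hC))
  let T : Set ((E × E × E) × (E × E × E)) := S ∩ ({z | IsLengthMin B z.1.1 z.1.2.1 z.1.2.2} ∩
    ({z | IsLengthMin B z.2.1 z.2.2.1 z.2.2.2} ∩ {z | ε ≤ ‖z.2.2.1 - z.1.2.1‖}))
  have hT : IsCompact T := by
    refine hS.inter_right (IsClosed.inter ?_ (IsClosed.inter ?_ ?_))
    · exact isClosed_setOf_isLengthMin hB.isClosed (by fun_prop) (by fun_prop) (by fun_prop)
    · exact isClosed_setOf_isLengthMin hB.isClosed (by fun_prop) (by fun_prop) (by fun_prop)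
    · exact isClosed_le (by fun_prop) (by fun_prop)
  let g : (E × E × E) × (E × E × E) → ℝ := fun z =>
    inner ℝ (kick z.2.1 z.2.2.1 z.2.2.2 - kick z.1.1 z.1.2.1 z.1.2.2) (z.2.2.1 - z.1.2.1)
  have hg : ContinuousOn g T := by
    refine ContinuousOn.inner (ContinuousOn.sub (ContinuousOn.sub ?_ ?_)
      (ContinuousOn.sub ?_ ?_)) (by fun_prop)
    · exact ContinuousOn.unitDir (Continuous.continuousOn (by fun_prop))
        (Continuous.continuousOn (by fun_prop))
        fun z hz => hCne hz.1.2.2.1 hz.1.2.2.2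
    · exact ContinuousOn.unitDir (Continuous.continuousOn (by fun_prop))
        (Continuous.continuousOn (by fun_prop))
        fun z hz => hAne hz.1.2.1 hz.1.2.2.1
    · exact ContinuousOn.unitDir (Continuous.continuousOn (by fun_prop))
        (Continuous.continuousOn (by fun_prop))
        fun z hz => hCne hz.1.1.2.1 hz.1.1.2.2
    · exact ContinuousOn.unitDir (Continuous.continuousOn (by fun_prop))
        (Continuous.continuousOn (by fun_prop))
        fun z hz => hAne hz.1.1.1 hz.1.1.2.1
  have hneg : ∀ p ∈ A, ∀ r ∈ C, ∀ q, IsLengthMin B p q r → ∀ y ∈ B, y ≠ q →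
      inner ℝ (kick p q r) (y - q) < 0 := fun p hp r hr q h y hy hne =>
    inner_neg_of_strictConvex hconv h.1 (kick_ne_zero (hseg p hp q h.1 r hr))
      (fun y hy => h.inner_kick_nonpos hconv.convex (disjoint_left.1 hAB hp)
        (disjoint_right.1 hBC hr) hy) hy hne
  have hpos : ∀ z ∈ T, 0 < g z := by
    rintro ⟨⟨p, q, r⟩, p', q', r'⟩ ⟨⟨⟨hp, hq, hr⟩, hp', hq', hr'⟩, h, h', hd⟩
    dsimp only at hp hq hr hp' hq' hr'
    change ε ≤ ‖q' - q‖ at hd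
    have hne : q' ≠ q := by rintro rfl; simp at hd; linarith
    have h1 := hneg p hp r hr q h q' hq' hne
    have h2 := hneg p' hp' r' hr' q' h' q hq hne.symm
    rw [← neg_sub, inner_neg_right] at h2
    change 0 < inner ℝ (kick p' q' r' - kick p q r) (q' - q)
    rw [inner_sub_left]
    linarith
  have key : ∃ δ > 0, ∀ z ∈ T, δ ≤ g z := by
    rcases T.eq_empty_or_nonempty with h | h
    · exact ⟨1, one_pos, by simp [h]⟩
    · obtain ⟨z, hz, hmin⟩ := hT.exists_isMinOn h hg
      exact ⟨g z, hpos z hz, fun w hw => hmin hw⟩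
  obtain ⟨δ, hδ, h⟩ := key
  exact ⟨δ, hδ, fun p hp r hr p' hp' r' hr' q q' hm hm' hd =>
    h ((p, q, r), (p', q', r')) ⟨⟨⟨hp, hm.1, hr⟩, hp', hm'.1, hr'⟩, hm, hm', hd⟩⟩

end Reflection

/-! ### Trajectories as length minimizing sequences -/

section Trajectory

variable {N s : ℕ} {K : Fin s → Set (EuclideanSpace ℝ (Fin N))}

/-- A sequence of points of the obstacles prescribed by `ξ`, each of which minimizes the length of
the two adjacent links. By the law of reflection these are the base points of the billiard
trajectories with itinerary `ξ`. -/
def IsTrajectory (K : Fin s → Set (EuclideanSpace ℝ (Fin N))) (ξ : ℤ → Fin s)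
    (q : ℤ → EuclideanSpace ℝ (Fin N)) : Prop :=
  ∀ i, IsLengthMin (K (ξ i)) (q (i - 1)) (q i) (q (i + 1))

namespace IsOpenBilliard

theorem notMem_segment (hK : IsOpenBilliard K) {i j k : Fin s} (hij : i ≠ j) (hjk : j ≠ k)
    {p q r : EuclideanSpace ℝ (Fin N)} (hp : p ∈ K i) (hq : q ∈ K j) (hr : r ∈ K k) :
    q ∉ segment ℝ p r := fun h =>
  disjoint_left.1 (hK.no_eclipse i k j hij hjk)
    (segment_subset_convexHull (s := K i ∪ K k) (Or.inl hp) (Or.inr hr) h) hq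

theorem notMem_of_ne (hK : IsOpenBilliard K) {i j : Fin s} (hij : i ≠ j)
    {p : EuclideanSpace ℝ (Fin N)} (hp : p ∈ K i) : p ∉ K j :=
  disjoint_left.1 (hK.pairwise_disjoint hij) hp

theorem exists_le_inner_kick_sub_kick (hK : IsOpenBilliard K) {ε : ℝ} (hε : 0 < ε) :
    ∃ δ > 0, ∀ i j k : Fin s, i ≠ j → j ≠ k →
      ∀ p ∈ K i, ∀ r ∈ K k, ∀ p' ∈ K i, ∀ r' ∈ K k, ∀ q q', IsLengthMin (K j) p q r →
      IsLengthMin (K j) p' q' r' → ε ≤ ‖q' - q‖ →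
        δ ≤ inner ℝ (kick p' q' r' - kick p q r) (q' - q) := by
  have : ∀ᶠ δ : ℝ in 𝓝[>] 0, ∀ i j k : Fin s, i ≠ j → j ≠ k →
      ∀ p ∈ K i, ∀ r ∈ K k, ∀ p' ∈ K i, ∀ r' ∈ K k, ∀ q q', IsLengthMin (K j) p q r →
      IsLengthMin (K j) p' q' r' → ε ≤ ‖q' - q‖ →
        δ ≤ inner ℝ (kick p' q' r' - kick p q r) (q' - q) := by
    refine eventually_all.2 fun i => eventually_all.2 fun j => eventually_all.2 fun k =>
      eventually_imp_distrib_left.2 fun hij => eventually_imp_distrib_left.2 fun hjk => ?_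
    obtain ⟨δ, hδ, h⟩ := _root_.exists_le_inner_kick_sub_kick (hK.isCompact i) (hK.isCompact j)
      (hK.isCompact k) (hK.strictConvex j) (hK.pairwise_disjoint hij)
      (hK.pairwise_disjoint hjk)
      (fun p hp q hq r hr => hK.notMem_segment hij hjk hp hq hr) hε
    filter_upwards [Ioo_mem_nhdsGT hδ] with δ' hδ' p hp r hr p' hp' r' hr' q q' hm hm' hd
    exact hδ'.2.le.trans (h p hp r hr p' hp' r' hr' q q' hm hm' hd)
  obtain ⟨δ, h, hδ⟩ := (this.and self_mem_nhdsWithin).exists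
  exact ⟨δ, hδ, h⟩

theorem exists_norm_le (hK : IsOpenBilliard K) : ∃ D > 0, ∀ i, ∀ x ∈ K i, ‖x‖ ≤ D := by
  obtain ⟨D, hD⟩ := (isCompact_iUnion hK.isCompact).isBounded.exists_norm_le
  exact ⟨max D 1, by positivity, fun i x hx =>
    (hD x (mem_iUnion.2 ⟨i, hx⟩)).trans (le_max_left _ _)⟩

/-- The base point depends uniformly continuously on the itinerary, and in particular is
determined by it. For two trajectories `q`, `q'` the function
`a i = ⟪v' i - v i, q' i - q i⟫` is bounded and increases along the common part of their
itineraries, and by at least a fixed amount wherever `q` and `q'` are not close. So `q` and `q'`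
are close somewhere before and somewhere after time `0`, where `a` is small, hence `a` does
not increase much at time `0` either. -/
theorem exists_norm_sub_lt (hK : IsOpenBilliard K) {ε : ℝ} (hε : 0 < ε) :
    ∃ k : ℕ, ∀ ξ η : SymbolSpace s, ∀ q q', IsTrajectory K ξ.1 q → IsTrajectory K η.1 q' →
      (∀ i : ℤ, -k ≤ i → i ≤ k → ξ.1 i = η.1 i) → ‖q' 0 - q 0‖ < ε := by
  obtain ⟨D, hD, hbound⟩ := hK.exists_norm_le
  obtain ⟨δ₁, hδ₁, h₁⟩ := hK.exists_le_inner_kick_sub_kick hε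
  obtain ⟨δ₂, hδ₂, h₂⟩ := hK.exists_le_inner_kick_sub_kick (show 0 < δ₁ / 8 by positivity)
  obtain ⟨m, hm⟩ := exists_nat_gt (8 * D / δ₂)
  rw [div_lt_iff₀ hδ₂] at hm
  refine ⟨m + 2, fun ξ η q q' hq hq' hag => ?_⟩
  set a : ℤ → ℝ := fun i =>
    inner ℝ (unitDir (q' i) (q' (i + 1)) - unitDir (q i) (q (i + 1))) (q' i - q i) with ha
  set g : ℤ → ℝ := fun i => inner ℝ
    (kick (q' (i - 1)) (q' i) (q' (i + 1)) - kick (q (i - 1)) (q i) (q (i + 1))) (q' i - q i)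
    with hg
  have hstep : ∀ i, a (i - 1) + g i ≤ a i := by
    intro i
    have := inner_unitDir_sub_unitDir_nonneg (q (i - 1)) (q i) (q' (i - 1)) (q' i)
    have e : (q' i - q' (i - 1)) - (q i - q (i - 1)) = (q' i - q i) - (q' (i - 1) - q (i - 1)) := by
      abel
    rw [e, inner_sub_right] at this
    simp only [ha, hg, kick, sub_add_cancel, inner_sub_left] at this ⊢
    linarith
  have habs : ∀ i, |a i| ≤ 2 * ‖q' i - q i‖ := by
    intro i
    refine (abs_real_inner_le_norm _ _).trans ?_
    gcongr
    refine (norm_sub_le _ _).trans ?_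
    linarith [norm_unitDir_le (q' i) (q' (i + 1)), norm_unitDir_le (q i) (q (i + 1))]
  have hD' : ∀ i, |a i| ≤ 4 * D := by
    intro i
    refine (habs i).trans ?_
    linarith [norm_sub_le (q' i) (q i), hbound _ _ (hq i).1, hbound _ _ (hq' i).1]
  have hgap : ∀ {δ κ : ℝ}, (∀ i j k : Fin s, i ≠ j → j ≠ k →
      ∀ p ∈ K i, ∀ r ∈ K k, ∀ p' ∈ K i, ∀ r' ∈ K k, ∀ q q', IsLengthMin (K j) p q r →
      IsLengthMin (K j) p' q' r' → κ ≤ ‖q' - q‖ →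
        δ ≤ inner ℝ (kick p' q' r' - kick p q r) (q' - q)) →
      ∀ i : ℤ, -(m + 1) ≤ i → i ≤ m + 1 → κ ≤ ‖q' i - q i‖ → δ ≤ g i := by
    intro δ κ h i hi1 hi2 hκ
    have e : ∀ j : ℤ, i - 1 ≤ j → j ≤ i + 1 → ξ.1 j = η.1 j := fun j hj1 hj2 =>
      hag j (by push_cast; omega) (by push_cast; omega)
    have n1 : ξ.1 (i - 1) ≠ ξ.1 i := by simpa using ξ.2 (i - 1)
    refine h _ _ _ n1 (ξ.2 i) _ (hq _).1 _ (hq _).1 _ ?_ _ ?_ _ _ (hq i) ?_ hκ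
    · rw [e _ le_rfl (by omega)]; exact (hq' _).1
    · rw [e _ (by omega) le_rfl]; exact (hq' _).1
    · rw [e _ (by omega) (by omega)]; exact hq' i
  have hg0 : ∀ i : ℤ, -(m + 1) ≤ i → i ≤ m + 1 → 0 ≤ g i := by
    intro i hi1 hi2
    rcases eq_or_ne (q' i) (q i) with h | h
    · simp [hg, h]
    · have hpos : 0 < ‖q' i - q i‖ := norm_pos_iff.2 (sub_ne_zero.2 h)
      obtain ⟨δ, hδ, h'⟩ := hK.exists_le_inner_kick_sub_kick hpos
      exact hδ.le.trans (hgap h' i hi1 hi2 le_rfl)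
  have hmono : ∀ (c : ℤ) (n : ℕ), -(m + 2) ≤ c → c + n ≤ m + 1 → a c ≤ a (c + n) := by
    intro c n hc
    induction n with
    | zero => simp
    | succ n ih =>
      intro hn
      have h1 := hstep (c + n + 1)
      have h2 := hg0 (c + n + 1) (by omega) (by push_cast at hn; omega)
      rw [add_sub_cancel_right] at h1
      have h3 := ih (by push_cast at hn; omega)
      push_cast
      rw [← add_assoc]
      linarith
  have hsmall : ∀ c : ℤ, -(m + 2) ≤ c → c + m ≤ m + 1 →
      ∃ n : ℕ, 1 ≤ n ∧ n ≤ m ∧ |a (c + n)| ≤ δ₁ / 4 := by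
    intro c hc1 hc2
    by_contra! hcon
    have hgrow : ∀ n : ℕ, n ≤ m → a c + n * δ₂ ≤ a (c + n) := by
      intro n
      induction n with
      | zero => simp
      | succ n ih =>
        intro hn
        have h1 := hstep (c + n + 1)
        rw [add_sub_cancel_right] at h1
        have h3 := ih (by omega)
        have h4 := hcon (n + 1) (by omega) hn
        have h5 := habs (c + (n + 1 : ℕ))
        have h2 := hgap h₂ (c + n + 1) (by omega) (by omega) (by
          push_cast at h4 h5
          rw [← add_assoc] at h4 h5
          linarith)
        push_cast
        rw [← add_assoc]
        linarith
    have h1 := hgrow m le_rfl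
    have h2 := abs_le.1 (hD' c)
    have h3 := abs_le.1 (hD' (c + m))
    linarith [h2.1, h3.2]
  by_contra! hcon
  obtain ⟨n, hn1, hn2, hn⟩ := hsmall 0 (by omega) (by omega)
  obtain ⟨n', hn1', hn2', hn'⟩ := hsmall (-(m + 1)) (by omega) (by omega)
  have e1 := hgap h₁ 0 (by omega) (by omega) hcon
  have e2 := hstep 0
  have e3 := hmono 0 n (by omega) (by omega)
  have e4 := hmono (-(m + 1) + n') (m - n') (by omega) (by omega)
  have e5 : (-(m + 1) + n' : ℤ) + (m - n' : ℕ) = 0 - 1 := by omega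
  rw [e5] at e4
  linarith [(abs_le.1 hn).2, (abs_le.1 hn').1]

/-- Existence of a trajectory with a given itinerary: minimize the length of longer and longer
broken lines and use compactness. -/
theorem exists_isTrajectory (hK : IsOpenBilliard K) (ξ : ℤ → Fin s) :
    ∃ q, IsTrajectory K ξ q := by
  have hP : IsCompact (univ.pi fun i => K (ξ i)) := isCompact_univ_pi fun i => hK.isCompact (ξ i)
  have hPne : (univ.pi fun i => K (ξ i)).Nonempty := univ_pi_nonempty_iff.2 fun i => hK.nonempty _
  let C : ℕ → Set (ℤ → EuclideanSpace ℝ (Fin N)) := fun n => (univ.pi fun i => K (ξ i)) ∩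
    ⋂ i : ℤ, ⋂ _ : -n < i ∧ i < n, {q | IsLengthMin (K (ξ i)) (q (i - 1)) (q i) (q (i + 1))}
  have hclosed : ∀ n, IsClosed (C n) := fun n => hP.isClosed.inter <|
    isClosed_iInter fun i => isClosed_iInter fun _ =>
      isClosed_setOf_isLengthMin (hK.isCompact _).isClosed (continuous_apply _)
        (continuous_apply _) (continuous_apply _)
  have hne : ∀ n, (C n).Nonempty := by
    intro n
    let F : (ℤ → EuclideanSpace ℝ (Fin N)) → ℝ := fun q =>
      ∑ i ∈ Finset.Ico (-n : ℤ) n, ‖q (i + 1) - q i‖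
    have hF : Continuous F := by fun_prop
    obtain ⟨q, hq, hmin⟩ := hP.exists_isMinOn hPne hF.continuousOn
    refine ⟨q, hq, mem_iInter₂.2 fun i hi => ⟨hq i (mem_univ i), fun y hy => ?_⟩⟩
    have hle : F q ≤ F (Function.update q i y) := by
      refine hmin fun j _ => ?_
      rcases eq_or_ne j i with rfl | h
      · simpa using hy
      · simpa [h] using hq j (mem_univ j)
    have hsplit : ∀ f : ℤ → ℝ, ∑ j ∈ Finset.Ico (-n : ℤ) n, f j =
        f (i - 1) + (f i + ∑ j ∈ ((Finset.Ico (-n : ℤ) n).erase (i - 1)).erase i, f j) := by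
      intro f
      rw [Finset.add_sum_erase _ _ (by simp; omega), Finset.add_sum_erase _ _ (by simp; omega)]
    simp only [F, hsplit] at hle
    have hrest : ∑ j ∈ ((Finset.Ico (-n : ℤ) n).erase (i - 1)).erase i,
          ‖Function.update q i y (j + 1) - Function.update q i y j‖ =
        ∑ j ∈ ((Finset.Ico (-n : ℤ) n).erase (i - 1)).erase i, ‖q (j + 1) - q j‖ := by
      refine Finset.sum_congr rfl fun j hj => ?_
      simp only [Finset.mem_erase] at hj
      rw [Function.update_of_ne (by omega), Function.update_of_ne hj.1]
    rw [hrest] at hle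
    simp only [sub_add_cancel, Function.update_self] at hle
    rw [Function.update_of_ne (by omega), Function.update_of_ne (by omega)] at hle
    linarith
  have hanti : ∀ n, C (n + 1) ⊆ C n := fun n q hq =>
    ⟨hq.1, mem_iInter₂.2 fun i hi => mem_iInter₂.1 hq.2 i (by omega)⟩
  obtain ⟨q, hq⟩ := IsCompact.nonempty_iInter_of_sequence_nonempty_isCompact_isClosed C hanti hne
    (hP.of_isClosed_subset (hclosed 0) inter_subset_left) hclosed
  refine ⟨q, fun i => ?_⟩
  have := (mem_iInter.1 hq (i.natAbs + 1)).2
  exact mem_iInter₂.1 this i (by omega)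

end IsOpenBilliard

end Trajectory

/-! ### Outer unit normals -/

section OuterNormal

variable {N : ℕ} {A : Set (EuclideanSpace ℝ (Fin N))} {x : EuclideanSpace ℝ (Fin N)}
  {f : EuclideanSpace ℝ (Fin N) → ℝ}

namespace IsDefiningFunctionAt

theorem congr_set {B : Set (EuclideanSpace ℝ (Fin N))} (hf : IsDefiningFunctionAt A x f)
    (h : ∀ᶠ y in 𝓝 x, y ∈ A ↔ y ∈ B) : IsDefiningFunctionAt B x f where
  contDiffAt := hf.contDiffAt
  gradient_ne_zero := hf.gradient_ne_zero
  eventually_mem_iff := by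
    filter_upwards [h, hf.eventually_mem_iff] with y h1 h2
    rw [← h1, h2]

theorem eq_zero_of_mem_frontier (hf : IsDefiningFunctionAt A x f) (hx : x ∈ frontier A) :
    f x = 0 := by
  have hc : ContinuousAt f x := hf.contDiffAt.continuousAt
  have hev := hf.eventually_mem_iff
  rw [frontier_eq_closure_inter_closure] at hx
  refine le_antisymm ?_ ?_
  · by_contra! h
    have h1 := mem_closure_iff_frequently.1 hx.1
    obtain ⟨y, hy, hy1, hy2⟩ :=
      (h1.and_eventually (hev.and (hc.eventually (lt_mem_nhds h)))).exists
    exact absurd (hy1.1 hy) (not_le.2 hy2)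
  · by_contra! h
    have h1 := mem_closure_iff_frequently.1 hx.2
    obtain ⟨y, hy, hy1, hy2⟩ :=
      (h1.and_eventually (hev.and (hc.eventually (gt_mem_nhds h)))).exists
    exact hy (hy1.2 (le_of_lt hy2))

theorem tendsto_slope (hf : IsDefiningFunctionAt A x f) (hx : x ∈ frontier A)
    (h : EuclideanSpace ℝ (Fin N)) :
    Tendsto (fun t : ℝ => t⁻¹ * f (x + t • h)) (𝓝[>] 0) (𝓝 (inner ℝ (gradient f x) h)) := by
  have hd : HasFDerivAt f (InnerProductSpace.toDual ℝ _ (gradient f x)) (x + (0 : ℝ) • h) := by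
    rw [zero_smul, add_zero]
    exact ((hf.contDiffAt.differentiableAt two_ne_zero).hasGradientAt).hasFDerivAt
  have hl : HasDerivAt (fun t : ℝ => x + t • h) h 0 := by
    simpa using ((hasDerivAt_id (0 : ℝ)).smul_const h).const_add x
  have := (hd.comp_hasDerivAt (0 : ℝ) hl).tendsto_slope_zero_right
  simpa [hf.eq_zero_of_mem_frontier hx] using this

theorem eventually_line_mem_iff (hf : IsDefiningFunctionAt A x f)
    (h : EuclideanSpace ℝ (Fin N)) :
    ∀ᶠ t : ℝ in 𝓝[>] 0, x + t • h ∈ A ↔ f (x + t • h) ≤ 0 := by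
  have hl : Tendsto (fun t : ℝ => x + t • h) (𝓝[>] 0) (𝓝 x) := by
    have : Continuous fun t : ℝ => x + t • h := by fun_prop
    simpa using (this.tendsto 0).mono_left nhdsWithin_le_nhds
  exact hl.eventually hf.eventually_mem_iff

theorem inner_gradient_nonpos (hf : IsDefiningFunctionAt A x f) (hx : x ∈ frontier A)
    {h : EuclideanSpace ℝ (Fin N)} (hh : ∀ᶠ t : ℝ in 𝓝[>] 0, x + t • h ∈ A) :
    inner ℝ (gradient f x) h ≤ 0 := by
  refine le_of_tendsto (hf.tendsto_slope hx h) ?_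
  filter_upwards [hh, hf.eventually_line_mem_iff h, self_mem_nhdsWithin] with t h1 h2 h3
  exact mul_nonpos_of_nonneg_of_nonpos (inv_nonneg.2 (le_of_lt h3)) (h2.1 h1)

theorem eventually_line_mem (hf : IsDefiningFunctionAt A x f) (hx : x ∈ frontier A)
    {h : EuclideanSpace ℝ (Fin N)} (hh : inner ℝ (gradient f x) h < 0) :
    ∀ᶠ t : ℝ in 𝓝[>] 0, x + t • h ∈ A := by
  filter_upwards [(hf.tendsto_slope hx h).eventually (gt_mem_nhds hh),
    hf.eventually_line_mem_iff h, self_mem_nhdsWithin] with t h1 h2 h3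
  refine h2.2 (le_of_lt ?_)
  have : 0 < t⁻¹ := inv_pos.2 h3
  by_contra! h4
  exact absurd (mul_nonneg this.le h4) (not_le.2 h1)

end IsDefiningFunctionAt

/-- Farkas' lemma for a single inequality: an open half-space `⟪m, ·⟫ < 0` lies in the half-space
`⟪n, ·⟫ ≤ 0` only if `n` is a positive multiple of `m`. -/
theorem inv_norm_smul_eq_of_inner_nonpos {E : Type*} [NormedAddCommGroup E]
    [InnerProductSpace ℝ E] {m n : E} (hm : m ≠ 0) (hn : n ≠ 0)
    (h : ∀ x, inner ℝ m x < 0 → inner ℝ n x ≤ 0) : ‖n‖⁻¹ • n = ‖m‖⁻¹ • m := by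
  have hm' := norm_pos_iff.2 hm
  have hn' := norm_pos_iff.2 hn
  have heq : inner ℝ m n = ‖m‖ * ‖n‖ := by
    refine (real_inner_le_norm m n).antisymm ?_
    by_contra! hlt
    have h1 := h (‖m‖ • n - ‖n‖ • m) (by
      rw [inner_sub_right, real_inner_smul_right, real_inner_smul_right,
        real_inner_self_eq_norm_sq]
      nlinarith)
    rw [inner_sub_right, real_inner_smul_right, real_inner_smul_right,
      real_inner_self_eq_norm_sq, real_inner_comm] at h1
    nlinarith
  have h1 := inner_eq_norm_mul_iff_real.1 heq
  calc ‖n‖⁻¹ • n = (‖n‖⁻¹ * ‖m‖⁻¹) • (‖m‖ • n) := by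
        rw [smul_smul]; congr 1; field_simp
    _ = ‖m‖⁻¹ • m := by
        rw [← h1, smul_smul]; congr 1; field_simp

namespace IsOuterUnitNormal

variable {ν : EuclideanSpace ℝ (Fin N)}

theorem norm_eq_one (h : IsOuterUnitNormal A x ν) : ‖ν‖ = 1 := by
  obtain ⟨-, f, hf, rfl⟩ := h
  rw [norm_smul, norm_inv, norm_norm, inv_mul_cancel₀ (norm_ne_zero_iff.2 hf.gradient_ne_zero)]

/-- A non-zero vector that makes no acute angle with the directions in which `A` can be entered
is a positive multiple of the outer unit normal. -/
theorem eq_inv_norm_smul (h : IsOuterUnitNormal A x ν) {w : EuclideanSpace ℝ (Fin N)}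
    (hw : w ≠ 0) (h' : ∀ y, (∀ᶠ t : ℝ in 𝓝[>] 0, x + t • y ∈ A) → inner ℝ w y ≤ 0) :
    ν = ‖w‖⁻¹ • w := by
  obtain ⟨hx, f, hf, rfl⟩ := h
  exact (inv_norm_smul_eq_of_inner_nonpos hf.gradient_ne_zero hw fun y hy =>
    h' y (hf.eventually_line_mem hx hy)).symm

protected theorem unique {ν' : EuclideanSpace ℝ (Fin N)} (h : IsOuterUnitNormal A x ν)
    (h' : IsOuterUnitNormal A x ν') : ν = ν' := by
  obtain ⟨hx, f, hf, rfl⟩ := h'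
  exact h.eq_inv_norm_smul hf.gradient_ne_zero fun y hy => hf.inner_gradient_nonpos hx hy

theorem inner_nonpos_of_convex (h : IsOuterUnitNormal A x ν)
    {L : Set (EuclideanSpace ℝ (Fin N))} (hL : Convex ℝ L) (hLA : L ⊆ A) (hx : x ∈ L)
    {y : EuclideanSpace ℝ (Fin N)} (hy : y ∈ L) : inner ℝ ν (y - x) ≤ 0 := by
  obtain ⟨hx', f, hf, rfl⟩ := h
  rw [real_inner_smul_left]
  refine mul_nonpos_of_nonneg_of_nonpos (inv_nonneg.2 (norm_nonneg _))
    (hf.inner_gradient_nonpos hx' ?_)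
  filter_upwards [Ioc_mem_nhdsGT (zero_lt_one' ℝ)] with t ht
  exact hLA (hL.add_smul_sub_mem hx hy ⟨ht.1.le, ht.2⟩)

end IsOuterUnitNormal

end OuterNormal

/-! ### The correspondence between trajectories and itineraries -/

section Itinerary

variable {N s : ℕ} {K : Fin s → Set (EuclideanSpace ℝ (Fin N))}

namespace IsOpenBilliard

theorem eventually_mem_iUnion_iff (hK : IsOpenBilliard K) {j : Fin s}
    {x : EuclideanSpace ℝ (Fin N)} (hx : x ∈ K j) : ∀ᶠ y in 𝓝 x, y ∈ K j ↔ y ∈ ⋃ k, K k := by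
  have : ∀ᶠ y in 𝓝 x, ∀ k, k ≠ j → y ∉ K k :=
    eventually_all.2 fun k => eventually_imp_distrib_left.2 fun hk =>
      (hK.isCompact k).isClosed.isOpen_compl.mem_nhds (hK.notMem_of_ne hk.symm hx)
  filter_upwards [this] with y hy
  refine ⟨fun h => mem_iUnion.2 ⟨j, h⟩, fun h => ?_⟩
  obtain ⟨k, hk⟩ := mem_iUnion.1 h
  by_contra hj
  exact hy k (fun e => hj (e ▸ hk)) hk

theorem mem_frontier_iUnion (hK : IsOpenBilliard K) {j : Fin s}
    {x : EuclideanSpace ℝ (Fin N)} (hx : x ∈ frontier (K j)) : x ∈ frontier (⋃ k, K k) := by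
  have hxj := (hK.isCompact j).isClosed.frontier_subset hx
  refine ⟨subset_closure (mem_iUnion.2 ⟨j, hxj⟩), fun hi => hx.2 ?_⟩
  rw [mem_interior_iff_mem_nhds] at hi ⊢
  filter_upwards [hi, hK.eventually_mem_iUnion_iff hxj] with y h1 h2
  exact h2.2 h1

/-- At a length minimizing point, the law of reflection holds: the impulse is directed along the
outer unit normal. -/
theorem isOuterUnitNormal_kick (hK : IsOpenBilliard K) {i j k : Fin s} (hij : i ≠ j)
    (hjk : j ≠ k) {p q r : EuclideanSpace ℝ (Fin N)} (hp : p ∈ K i) (hr : r ∈ K k)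
    (h : IsLengthMin (K j) p q r) :
    q ∈ frontier (K j) ∧ IsOuterUnitNormal (⋃ k, K k) q (‖kick p q r‖⁻¹ • kick p q r) := by
  have hne := kick_ne_zero (hK.notMem_segment hij hjk hp h.1 hr)
  have hvi : ∀ y ∈ K j, inner ℝ (kick p q r) (y - q) ≤ 0 := fun y hy =>
    h.inner_kick_nonpos (hK.strictConvex j).convex (hK.notMem_of_ne hij hp)
      (hK.notMem_of_ne hjk.symm hr) hy
  have hq := mem_frontier_of_inner_nonpos h.1 hne hvi
  refine ⟨hq, ?_⟩
  obtain ⟨f, hf⟩ := hK.hasC2Boundary j q hq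
  have hν : IsOuterUnitNormal (K j) q (‖gradient f q‖⁻¹ • gradient f q) := ⟨hq, f, hf, rfl⟩
  refine ⟨hK.mem_frontier_iUnion hq, f, hf.congr_set (hK.eventually_mem_iUnion_iff h.1), ?_⟩
  refine (hν.eq_inv_norm_smul hne fun y hy => ?_).symm
  obtain ⟨t, ht, ht0⟩ := (hy.and self_mem_nhdsWithin).exists
  have := hvi _ ht
  rw [add_sub_cancel_left, real_inner_smul_right] at this
  exact nonpos_of_mul_nonpos_right this ht0

theorem hasItinerary_of_isTrajectory (hK : IsOpenBilliard K) (ξ : SymbolSpace s)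
    {q : ℤ → EuclideanSpace ℝ (Fin N)} (hq : IsTrajectory K ξ.1 q) :
    HasItinerary K ξ (q 0, unitDir (q 0) (q 1)) := by
  have hmem : ∀ i, q i ∈ K (ξ.1 i) := fun i => (hq i).1
  have hξ : ∀ i, ξ.1 (i - 1) ≠ ξ.1 i := fun i => by simpa using ξ.2 (i - 1)
  have hne : ∀ i, q i ≠ q (i + 1) := fun i e =>
    hK.notMem_of_ne (ξ.2 i) (hmem i) (e ▸ hmem (i + 1))
  have hne' : ∀ i, q (i - 1) ≠ q i := fun i => by simpa using hne (i - 1)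
  set w : ℤ → EuclideanSpace ℝ (Fin N) := fun i => kick (q (i - 1)) (q i) (q (i + 1)) with hw
  have hw0 : ∀ i, 0 < ‖w i‖ := fun i => norm_pos_iff.2 <|
    kick_ne_zero (hK.notMem_segment (hξ i) (ξ.2 i) (hmem _) (hmem _) (hmem _))
  have hnormal : ∀ i, q i ∈ frontier (K (ξ.1 i)) ∧
      IsOuterUnitNormal (⋃ k, K k) (q i) (‖w i‖⁻¹ • w i) := fun i =>
    hK.isOuterUnitNormal_kick (hξ i) (ξ.2 i) (hmem _) (hmem _) (hq i)
  have hvi : ∀ i, ∀ y ∈ K (ξ.1 i), inner ℝ (w i) (y - q i) ≤ 0 := fun i y hy =>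
    (hq i).inner_kick_nonpos (hK.strictConvex _).convex
      (hK.notMem_of_ne (hξ i) (hmem _)) (hK.notMem_of_ne (ξ.2 i).symm (hmem _)) hy
  have hout : ∀ i, 0 < inner ℝ (w i) (q (i + 1) - q i) := fun i => by
    rw [← norm_smul_unitDir, real_inner_smul_right, hw, inner_kick_unitDir_right (hne' i) (hne i)]
    have := hw0 i
    have := norm_pos_iff.2 (sub_ne_zero.2 (hne i).symm)
    positivity
  have hin : ∀ i, inner ℝ (w i) (q i - q (i - 1)) < 0 := fun i => by
    rw [← norm_smul_unitDir, real_inner_smul_right, hw, inner_kick_unitDir_left (hne' i) (hne i)]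
    have := hw0 i
    have := norm_pos_iff.2 (sub_ne_zero.2 (hne' i).symm)
    rw [mul_neg, neg_lt_zero]
    positivity
  have hphase : ∀ i, (q i, unitDir (q i) (q (i + 1))) ∈ phaseSpace (⋃ k, K k) := by
    refine fun i => ⟨(hnormal i).2.1, norm_unitDir (hne i), _, (hnormal i).2, ?_⟩
    rw [real_inner_smul_left, unitDir, real_inner_smul_right]
    have := hw0 i
    have := norm_pos_iff.2 (sub_ne_zero.2 (hne i).symm)
    have := hout i
    positivity
  refine ⟨fun i => (q i, unitDir (q i) (q (i + 1))), by simp, fun i => ?_, fun i => (hnormal i).1⟩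
  refine ⟨hphase i, hphase (i + 1), ⟨‖q (i + 1) - q i‖,
    norm_pos_iff.2 (sub_ne_zero.2 (hne i).symm), ?_⟩, ?_, _, (hnormal (i + 1)).2, ?_⟩
  · simp [norm_smul_unitDir]
  · rw [disjoint_left]
    rintro z hz hzf
    have hzA := (isClosed_iUnion_of_finite fun k => (hK.isCompact k).isClosed).frontier_subset hzf
    obtain ⟨k, hk⟩ := mem_iUnion.1 hzA
    rw [openSegment_eq_image'] at hz
    obtain ⟨t, ⟨ht0, ht1⟩, rfl⟩ := hz
    dsimp only at hk
    by_cases h1 : k = ξ.1 i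
    · subst h1
      have h2 := hvi i _ hk
      rw [add_sub_cancel_left, real_inner_smul_right] at h2
      exact absurd h2 (not_le.2 (mul_pos ht0 (hout i)))
    by_cases h1' : k = ξ.1 (i + 1)
    · subst h1'
      have h2 := hvi (i + 1) _ hk
      have h3 := hin (i + 1)
      rw [add_sub_cancel_right] at h3
      have e : q i + t • (q (i + 1) - q i) - q (i + 1) = -((1 - t) • (q (i + 1) - q i)) := by
        module
      rw [e, inner_neg_right, real_inner_smul_right] at h2
      nlinarith
    · refine hK.notMem_segment (Ne.symm h1) h1' (hmem i) hk (hmem (i + 1)) ?_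
      rw [segment_eq_image']
      exact ⟨t, ⟨ht0.le, ht1.le⟩, rfl⟩
  · dsimp only
    have h1 := inner_kick_unitDir_left (hne' (i + 1)) (hne (i + 1))
    have h2 : w (i + 1) = unitDir (q (i + 1)) (q (i + 1 + 1)) - unitDir (q i) (q (i + 1)) := by
      simp [hw, kick]
    change inner ℝ (w (i + 1)) _ = -(‖w (i + 1)‖ ^ 2 / 2) at h1
    rw [add_sub_cancel_right] at h1
    rw [real_inner_smul_right, real_inner_comm, h1, smul_smul]
    have h3 : 2 * (‖w (i + 1)‖⁻¹ * -(‖w (i + 1)‖ ^ 2 / 2)) * ‖w (i + 1)‖⁻¹ = -1 := by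
      have := (hw0 (i + 1)).ne'
      field_simp
    rw [h3, h2]
    module

theorem isTrajectory_of_hasItinerary (hK : IsOpenBilliard K) (ξ : SymbolSpace s)
    {x : EuclideanSpace ℝ (Fin N) × EuclideanSpace ℝ (Fin N)} (hx : HasItinerary K ξ x) :
    ∃ q, IsTrajectory K ξ.1 q ∧ x = (q 0, unitDir (q 0) (q 1)) := by
  obtain ⟨γ, rfl, hstep, hfr⟩ := hx
  have hv : ∀ i, (γ i).2 = unitDir (γ i).1 (γ (i + 1)).1 := by
    intro i
    obtain ⟨t, ht, h⟩ := (hstep i).on_ray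
    have h1 : (γ (i + 1)).1 - (γ i).1 = t • (γ i).2 := by rw [h, add_sub_cancel_left]
    rw [unitDir, h1, norm_smul, (hstep i).source_mem.2.1, Real.norm_of_nonneg ht.le, mul_one,
      smul_smul, inv_mul_cancel₀ ht.ne', one_smul]
  have hmem : ∀ i, (γ i).1 ∈ K (ξ.1 i) := fun i => (hK.isCompact _).isClosed.frontier_subset (hfr i)
  have key : ∀ i, IsLengthMin (K (ξ.1 (i + 1))) (γ i).1 (γ (i + 1)).1 (γ (i + 1 + 1)).1 := by
    intro i
    refine isLengthMin_of_inner_kick_nonpos (hmem _) fun y hy => ?_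
    obtain ⟨ν, hν, hrefl⟩ := (hstep i).reflection
    obtain ⟨-, -, ν', hν', hpos⟩ := (hstep i).target_mem
    obtain rfl := hν.unique hν'
    have hν1 := hν.norm_eq_one
    have hneg : inner ℝ (γ i).2 ν < 0 := by
      rw [hrefl, inner_sub_right, real_inner_smul_right, real_inner_self_eq_norm_sq, hν1,
        real_inner_comm] at hpos
      linarith
    rw [kick, ← hv, ← hv, hrefl, sub_sub_cancel_left, inner_neg_left, real_inner_smul_left]
    have := hν.inner_nonpos_of_convex (hK.strictConvex (ξ.1 (i + 1))).convex
      (subset_iUnion K _) (hmem _) hy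
    nlinarith
  refine ⟨fun i => (γ i).1, fun i => ?_, Prod.ext rfl ?_⟩
  · simpa using key (i - 1)
  · simpa using hv 0

theorem existsUnique_hasItinerary (hK : IsOpenBilliard K) (ξ : SymbolSpace s) :
    ∃! x, HasItinerary K ξ x := by
  obtain ⟨q, hq⟩ := hK.exists_isTrajectory ξ.1
  refine ⟨_, hK.hasItinerary_of_isTrajectory ξ hq, fun x hx => ?_⟩
  obtain ⟨q', hq', rfl⟩ := hK.isTrajectory_of_hasItinerary ξ hx
  -- Translates of trajectories are trajectories, so it is enough to compare points at time `0`.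
  have heq : ∀ i, q' i = q i := by
    intro i
    by_contra h
    obtain ⟨k, hk⟩ := hK.exists_norm_sub_lt (norm_pos_iff.2 (sub_ne_zero.2 h))
    let η : SymbolSpace s := ⟨fun j => ξ.1 (j + i), fun j => by
      have := ξ.2 (j + i); rwa [add_right_comm] at this⟩
    have htr : ∀ q, IsTrajectory K ξ.1 q → IsTrajectory K η.1 fun j => q (j + i) := by
      intro q hq j
      have := hq (j + i)
      rwa [← sub_add_eq_add_sub, add_right_comm] at this
    have := hk η η _ _ (htr q hq) (htr q' hq') fun _ _ _ => rfl
    simp at this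
  rw [heq, heq]

theorem startingPoint_eq (hK : IsOpenBilliard K) {ξ : SymbolSpace s}
    {q : ℤ → EuclideanSpace ℝ (Fin N)} (hq : IsTrajectory K ξ.1 q) :
    startingPoint K ξ = q 0 := by
  have h : ∃ x, HasItinerary K ξ x := ⟨_, hK.hasItinerary_of_isTrajectory ξ hq⟩
  rw [startingPoint, dif_pos h, (hK.existsUnique_hasItinerary ξ).unique h.choose_spec
    (hK.hasItinerary_of_isTrajectory ξ hq)]

theorem exists_norm_startingPoint_le (hK : IsOpenBilliard K) :
    ∃ M, ∀ ξ, ‖startingPoint K ξ‖ ≤ M := by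
  obtain ⟨D, -, hD⟩ := hK.exists_norm_le
  refine ⟨D, fun ξ => ?_⟩
  obtain ⟨q, hq⟩ := hK.exists_isTrajectory ξ.1
  rw [hK.startingPoint_eq hq]
  exact hD _ _ (hq 0).1

end IsOpenBilliard

end Itinerary

/-! ### Greedy approximation of a convex combination -/

section Greedy

/-- If the point `ρ` cannot be separated from the points `r b` by a hyperplane, a greedy choice of
a sequence among them keeps the weighted discrepancy from `ρ` small: each summand is chosen to
make no acute angle with the sum of the previous ones. -/
theorem exists_seq_norm_sum_sq_le {E ι : Type*} [NormedAddCommGroup E] [InnerProductSpace ℝ E]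
    {r : ι → E} {ρ : E} {B : ℝ} (hB : ∀ b, ‖r b - ρ‖ ≤ B)
    (hsep : ∀ D : E, ∃ b, inner ℝ D (r b - ρ) ≤ 0) {w : ℕ → ℝ} (hw : ∀ l, 0 ≤ w l) :
    ∃ c : ℕ → ι, ∀ m, ‖∑ l ∈ Finset.range m, w l • (r (c l) - ρ)‖ ^ 2 ≤
      ∑ l ∈ Finset.range m, (w l * B) ^ 2 := by
  choose f hf using hsep
  let D : ℕ → E := fun m => Nat.rec 0 (fun l d => d + w l • (r (f d) - ρ)) m
  have hD : ∀ m, ∑ l ∈ Finset.range m, w l • (r (f (D l)) - ρ) = D m := by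
    intro m
    induction m with
    | zero => rfl
    | succ m ih => rw [Finset.sum_range_succ, ih]
  refine ⟨fun l => f (D l), fun m => ?_⟩
  induction m with
  | zero => simp
  | succ m ih =>
    rw [Finset.sum_range_succ, Finset.sum_range_succ _ m, norm_add_sq_real, hD,
      real_inner_smul_right, norm_smul, Real.norm_of_nonneg (hw m)]
    rw [hD] at ih
    have h1 := mul_nonpos_of_nonneg_of_nonpos (hw m) (hf (D m))
    have h2 : (w m * ‖r (f (D m)) - ρ‖) ^ 2 ≤ (w m * B) ^ 2 := by
      have := hB (f (D m))
      have := hw m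
      gcongr
    linarith

end Greedy

/-! ### Rotation vectors of symbolic sequences -/

section Symbolic

variable {N s : ℕ} {φ : SymbolSpace s → EuclideanSpace ℝ (Fin N)}

theorem shift_iterate_apply (ξ : SymbolSpace s) (k : ℕ) (i : ℤ) :
    (shift^[k] ξ).1 i = ξ.1 (i + k) := by
  induction k generalizing ξ with
  | zero => simp
  | succ k ih =>
    rw [Function.iterate_succ_apply, ih]
    change ξ.1 (i + k + 1) = _
    push_cast
    rw [add_assoc]

/-- Uniform continuity of an observable: up to any `ε > 0`, its value depends on a window of
symbols around time `0` only. -/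
def IsUniformlyLocal (φ : SymbolSpace s → EuclideanSpace ℝ (Fin N)) : Prop :=
  ∀ ε > 0, ∃ k : ℕ, ∀ ξ η : SymbolSpace s, (∀ i : ℤ, -k ≤ i → i ≤ k → ξ.1 i = η.1 i) →
    ‖φ ξ - φ η‖ ≤ ε

/-- Two orbits with the same symbols at the times `0, …, n - 1` have Birkhoff sums of length `n`
that differ by `o(n)`, uniformly. -/
theorem IsUniformlyLocal.norm_birkhoffSum_sub_le (hφ : IsUniformlyLocal φ) {M : ℝ}
    (hM : ∀ ξ, ‖φ ξ‖ ≤ M) {ε : ℝ} (hε : 0 < ε) :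
    ∃ C, ∀ (n : ℕ) (ξ η : SymbolSpace s), (∀ i : ℕ, i < n → ξ.1 i = η.1 i) →
      ‖birkhoffSum shift φ n ξ - birkhoffSum shift φ n η‖ ≤ ε * n + C := by
  obtain ⟨k, hk⟩ := hφ ε hε
  refine ⟨2 * M * (2 * k), fun n ξ η h => ?_⟩
  have hM0 : 0 ≤ M := (norm_nonneg _).trans (hM ξ)
  rw [birkhoffSum, birkhoffSum, ← Finset.sum_sub_distrib]
  have hterm : ∀ i ∈ Finset.range n, ‖φ (shift^[i] ξ) - φ (shift^[i] η)‖ ≤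
      ε + ((if i < k then 2 * M else 0) + if n - k ≤ i then 2 * M else 0) := by
    intro i hi
    rw [Finset.mem_range] at hi
    have hle : ‖φ (shift^[i] ξ) - φ (shift^[i] η)‖ ≤ 2 * M := by
      refine (norm_sub_le _ _).trans ?_
      linarith [hM (shift^[i] ξ), hM (shift^[i] η)]
    by_cases h1 : i < k
    · rw [if_pos h1]; split_ifs <;> linarith
    by_cases h2 : n - k ≤ i
    · rw [if_neg h1, if_pos h2]; linarith
    rw [if_neg h1, if_neg h2]
    simp only [add_zero]
    refine hk _ _ fun j hj1 hj2 => ?_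
    rw [shift_iterate_apply, shift_iterate_apply]
    have := h (j + i).toNat (by omega)
    rwa [Int.toNat_of_nonneg (by omega)] at this
  refine (norm_sum_le _ _).trans ((Finset.sum_le_sum hterm).trans ?_)
  rw [Finset.sum_add_distrib, Finset.sum_add_distrib, ← Finset.sum_filter, ← Finset.sum_filter]
  simp only [Finset.sum_const, Finset.card_range, nsmul_eq_mul]
  have c1 : ((Finset.range n).filter (· < k)).card ≤ k :=
    (Finset.card_le_card fun i hi => Finset.mem_range.2 (Finset.mem_filter.1 hi).2).trans
      (Finset.card_range k).le
  have c2 : ((Finset.range n).filter (n - k ≤ ·)).card ≤ k := by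
    refine (Finset.card_le_card (t := Finset.Ico (n - k) n) fun i hi => ?_).trans
      (by rw [Nat.card_Ico]; omega)
    rw [Finset.mem_filter, Finset.mem_range] at hi
    exact Finset.mem_Ico.2 hi.symm
  have c1' : (((Finset.range n).filter (· < k)).card : ℝ) ≤ k := by exact_mod_cast c1
  have c2' : (((Finset.range n).filter (n - k ≤ ·)).card : ℝ) ≤ k := by exact_mod_cast c2
  nlinarith

/-- `ρ` is the rotation vector of `ξ` if and only if the Birkhoff sums differ from `n • ρ`
by `o(n)`. -/
theorem isRotationVector_iff {ξ : SymbolSpace s} {ρ : EuclideanSpace ℝ (Fin N)} :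
    IsRotationVector φ ξ ρ ↔
      ∀ ε > 0, ∃ C, ∀ n : ℕ, ‖birkhoffSum shift φ n ξ - (n : ℝ) • ρ‖ ≤ ε * n + C := by
  have hscale : ∀ n : ℕ, 0 < n → ‖birkhoffSum shift φ n ξ - (n : ℝ) • ρ‖ =
      n * ‖birkhoffAverage ℝ shift φ n ξ - ρ‖ := by
    intro n hn
    have hn' : (n : ℝ) ≠ 0 := by positivity
    rw [← Real.norm_natCast, ← norm_smul, smul_sub, birkhoffAverage, smul_smul, Real.norm_natCast,
      mul_inv_cancel₀ hn', one_smul]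
  constructor
  · intro h ε hε
    obtain ⟨n₀, hn₀⟩ := Metric.tendsto_atTop.1 h ε hε
    refine ⟨∑ i ∈ Finset.range (n₀ + 1), ‖birkhoffSum shift φ i ξ - (i : ℝ) • ρ‖, fun n => ?_⟩
    rcases lt_or_ge n₀ n with hn | hn
    · have h1 := (dist_eq_norm _ ρ ▸ hn₀ n hn.le).le
      have h2 : 0 ≤ ∑ i ∈ Finset.range (n₀ + 1), ‖birkhoffSum shift φ i ξ - (i : ℝ) • ρ‖ :=
        Finset.sum_nonneg fun _ _ => norm_nonneg _
      rw [hscale n (by omega)]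
      have h3 : (n : ℝ) * ‖birkhoffAverage ℝ shift φ n ξ - ρ‖ ≤ n * ε := by gcongr
      linarith
    · have := Finset.single_le_sum (f := fun i : ℕ => ‖birkhoffSum shift φ i ξ - (i : ℝ) • ρ‖)
        (fun _ _ => norm_nonneg _) (Finset.mem_range.2 (Nat.lt_succ_of_le hn))
      have h0 : 0 ≤ ε * n := by positivity
      linarith
  · intro h
    refine Metric.tendsto_atTop.2 fun ε hε => ?_
    obtain ⟨C, hC⟩ := h (ε / 2) (by positivity)
    obtain ⟨n₀, hn₀⟩ := exists_nat_gt (2 * C / ε)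
    rw [div_lt_iff₀ hε] at hn₀
    refine ⟨n₀ + 1, fun n hn => ?_⟩
    have h1 := hC n
    have hn' : (n₀ : ℝ) + 1 ≤ n := by exact_mod_cast hn
    have hpos : (0 : ℝ) < n := by linarith [(Nat.cast_nonneg n₀ : (0 : ℝ) ≤ n₀)]
    rw [hscale n (by omega)] at h1
    rw [dist_eq_norm]
    by_contra! hcon
    nlinarith

theorem isRotationVector_of_isPeriodicPt {η : SymbolSpace s} {p : ℕ} (hp : 0 < p)
    (h : Function.IsPeriodicPt shift p η) :
    IsRotationVector φ η ((p : ℝ)⁻¹ • birkhoffSum shift φ p η) := by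
  set ρ := (p : ℝ)⁻¹ • birkhoffSum shift φ p η with hρ
  have hp' : (p : ℝ) ≠ 0 := by positivity
  have hpρ : (p : ℝ) • ρ = birkhoffSum shift φ p η := by
    rw [hρ, smul_smul, mul_inv_cancel₀ hp', one_smul]
  have hper : Function.Periodic (fun n : ℕ => birkhoffSum shift φ n η - (n : ℝ) • ρ) p := by
    intro n
    dsimp only
    rw [add_comm, birkhoffSum_add, h.eq, Nat.cast_add, add_smul, hpρ]
    abel
  rw [isRotationVector_iff]
  intro ε hε
  refine ⟨∑ i ∈ Finset.range p, ‖birkhoffSum shift φ i η - (i : ℝ) • ρ‖, fun n => ?_⟩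
  have h1 := Finset.single_le_sum (f := fun i : ℕ => ‖birkhoffSum shift φ i η - (i : ℝ) • ρ‖)
    (fun _ _ => norm_nonneg _) (Finset.mem_range.2 (Nat.mod_lt n hp))
  have h2 := hper.map_mod_nat n
  rw [h2] at h1
  have h0 : 0 ≤ ε * n := by positivity
  linarith

theorem exists_ne_and_ne (hs : 3 ≤ s) (x y : Fin s) : ∃ z, z ≠ x ∧ z ≠ y := by
  by_contra! h
  have h1 : (Finset.univ : Finset (Fin s)) ⊆ {x, y} := fun z _ => by
    rw [Finset.mem_insert, Finset.mem_singleton]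
    exact or_iff_not_imp_left.2 (h z)
  have h2 := (Finset.card_le_card h1).trans Finset.card_le_two
  rw [Finset.card_univ, Fintype.card_fin] at h2
  omega

/-- Every word of length `n` extends to a periodic sequence of period `n + 1`: an additional
symbol makes the junction admissible. -/
theorem exists_isPeriodicPt_eq (hs : 3 ≤ s) (ξ : SymbolSpace s) {n : ℕ} (hn : 0 < n) :
    ∃ η : SymbolSpace s, Function.IsPeriodicPt shift (n + 1) η ∧
      ∀ i : ℕ, i < n → ξ.1 i = η.1 i := by
  obtain ⟨z, hz1, hz2⟩ := exists_ne_and_ne hs (ξ.1 (n - 1)) (ξ.1 0)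
  have hmod : ∀ i : ℤ, 0 ≤ i % (n + 1) ∧ i % (n + 1) < n + 1 := fun i =>
    ⟨Int.emod_nonneg _ (by omega), Int.emod_lt_of_pos _ (by omega)⟩
  let a : ℤ → Fin s := fun i => if i % (n + 1) < n then ξ.1 (i % (n + 1)) else z
  have ha : ∀ i, a i ≠ a (i + 1) := by
    intro i
    have hi := hmod i
    rcases eq_or_lt_of_le (Int.lt_add_one_iff.1 hi.2) with h | h
    · have h' : (i + 1) % ((n : ℤ) + 1) = 0 := by
        rw [← Int.emod_add_emod, h, Int.emod_self]
      simp only [a, h, h', lt_irrefl, if_false]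
      rwa [if_pos (by omega)]
    · have h' : (i + 1) % ((n : ℤ) + 1) = i % (n + 1) + 1 := by
        rw [← Int.emod_add_emod, Int.emod_eq_of_lt (by omega) (by omega)]
      simp only [a, h, h', if_true]
      split_ifs with h2
      · exact ξ.2 _
      · have : i % ((n : ℤ) + 1) = n - 1 := by omega
        rw [this]
        exact hz1.symm
  refine ⟨⟨a, ha⟩, Subtype.ext (funext fun i => ?_), fun i hi => ?_⟩
  · refine (shift_iterate_apply _ _ _).trans ?_
    change a (i + (n + 1 : ℕ)) = a i
    simp [a]
  · change ξ.1 i = a i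
    have : (i : ℤ) % (n + 1) = i := Int.emod_eq_of_lt (by omega) (by omega)
    simp only [a, this]
    rw [if_pos (by omega)]

/-- Given sequences `ζ l`, some admissible sequence agrees at the time `l ^ 2` with the first
`2 * l` symbols of `ζ l`, for every `l`. The symbol at the time `l ^ 2 + 2 * l`, the last one before
`(l + 1) ^ 2`, makes the junction admissible; negative times are filled in by reflection. -/
theorem exists_concatenation (hs : 3 ≤ s) (ζ : ℕ → SymbolSpace s) :
    ∃ ξ : SymbolSpace s, ∀ l j : ℕ, j < 2 * l → (shift^[l ^ 2] ξ).1 j = (ζ l).1 j := by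
  choose third hth1 hth2 using exists_ne_and_ne hs
  let a : ℕ → Fin s := fun i =>
    if i - i.sqrt * i.sqrt < 2 * i.sqrt then (ζ i.sqrt).1 (i - i.sqrt * i.sqrt : ℕ)
    else third ((ζ i.sqrt).1 (2 * i.sqrt - 1)) ((ζ (i.sqrt + 1)).1 0)
  have hsqrt : ∀ l j : ℕ, j ≤ 2 * l → (l * l + j).sqrt = l := fun l j h =>
    Nat.sqrt_add_eq l (by omega)
  have ha1 : ∀ l j : ℕ, j < 2 * l → a (l * l + j) = (ζ l).1 j := by
    intro l j h
    simp only [a, hsqrt l j h.le, Nat.add_sub_cancel_left, if_pos h]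
  have ha2 : ∀ l : ℕ, a (l * l + 2 * l) = third ((ζ l).1 (2 * l - 1)) ((ζ (l + 1)).1 0) := by
    intro l
    simp only [a, hsqrt l _ le_rfl, Nat.add_sub_cancel_left, lt_irrefl, if_false]
  have ha : ∀ i, a i ≠ a (i + 1) := by
    intro i
    obtain ⟨l, j, hj, rfl⟩ : ∃ l j, j ≤ 2 * l ∧ i = l * l + j :=
      ⟨i.sqrt, i - i.sqrt * i.sqrt, by have := Nat.sqrt_le_add i; omega,
        by have := Nat.sqrt_le i; omega⟩
    rcases lt_trichotomy (j + 1) (2 * l) with h | h | h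
    · rw [ha1 l j (by omega), add_assoc, ha1 l (j + 1) h]
      exact (ζ l).2 j
    · rw [ha1 l j (by omega), add_assoc, h, ha2]
      have : (j : ℤ) = 2 * l - 1 := by omega
      rw [this]
      exact (hth1 _ _).symm
    · obtain rfl : j = 2 * l := by omega
      have e : l * l + 2 * l + 1 = (l + 1) * (l + 1) + 0 := by ring
      rw [ha2, e, ha1 (l + 1) 0 (by omega)]
      exact hth2 _ _
  refine ⟨⟨fun i => a i.natAbs, fun i => ?_⟩, fun l j h => ?_⟩
  · change a i.natAbs ≠ a (i + 1).natAbs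
    rcases lt_or_ge i 0 with h | h
    · have e : i.natAbs = (i + 1).natAbs + 1 := by omega
      rw [e]
      exact (ha _).symm
    · have e : (i + 1).natAbs = i.natAbs + 1 := by omega
      rw [e]
      exact ha _
  · refine (shift_iterate_apply _ _ _).trans ?_
    change a ((j : ℤ) + (l ^ 2 : ℕ)).natAbs = _
    have e : ((j : ℤ) + (l ^ 2 : ℕ)).natAbs = l * l + j := by
      rw [← Nat.cast_add, Int.natAbs_natCast]; ring
    rw [e, ha1 l j h]

/-- If `ξ` follows `ζ l` on the block `[l ^ 2, l ^ 2 + 2 * l)`, with each `ζ l` one of finitely many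
sequences, then its Birkhoff sums are close to the sums of the rotation vectors followed. -/
theorem IsUniformlyLocal.norm_birkhoffSum_sq_sub_le {ι : Type*} [Finite ι]
    (hφ : IsUniformlyLocal φ) {M : ℝ} (hM : ∀ ξ, ‖φ ξ‖ ≤ M) {η : ι → SymbolSpace s}
    {r : ι → EuclideanSpace ℝ (Fin N)} (hr : ∀ b, IsRotationVector φ (η b) (r b)) {c : ℕ → ι}
    {ξ : SymbolSpace s}
    (hξ : ∀ l j : ℕ, j < 2 * l → (shift^[l ^ 2] ξ).1 j = (η (c l)).1 j) {ε : ℝ} (hε : 0 < ε) :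
    ∃ C, ∀ m : ℕ, ‖birkhoffSum shift φ (m ^ 2) ξ -
      ∑ l ∈ Finset.range m, (2 * l + 1 : ℝ) • r (c l)‖ ≤ ε * m ^ 2 + C * m := by
  have hM0 : 0 ≤ M := (norm_nonneg _).trans (hM ξ)
  obtain ⟨C₁, hC₁⟩ := hφ.norm_birkhoffSum_sub_le hM (half_pos hε)
  choose C₂ hC₂ using fun b => isRotationVector_iff.1 (hr b) (ε / 2) (half_pos hε)
  obtain ⟨C₃, hC₃⟩ := (Set.finite_range fun b => C₂ b + ‖r b‖).bddAbove
  have hblock : ∀ l, ‖birkhoffSum shift φ (2 * l + 1) (shift^[l ^ 2] ξ) -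
      (2 * l + 1 : ℝ) • r (c l)‖ ≤ ε * (2 * l + 1) + (C₁ + C₃ + M) := by
    intro l
    have h1 := hC₁ (2 * l) (shift^[l ^ 2] ξ) (η (c l)) (hξ l)
    have h2 := hC₂ (c l) (2 * l)
    have h3 : C₂ (c l) + ‖r (c l)‖ ≤ C₃ := hC₃ (mem_range_self (c l))
    have h4 := hM (shift^[2 * l] (shift^[l ^ 2] ξ))
    push_cast at h1 h2
    rw [birkhoffSum_succ]
    have e : birkhoffSum shift φ (2 * l) (shift^[l ^ 2] ξ) +
        φ (shift^[2 * l] (shift^[l ^ 2] ξ)) - (2 * l + 1 : ℝ) • r (c l) =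
        (birkhoffSum shift φ (2 * l) (shift^[l ^ 2] ξ) - birkhoffSum shift φ (2 * l) (η (c l))) +
        (birkhoffSum shift φ (2 * l) (η (c l)) - (2 * l : ℝ) • r (c l)) +
        (φ (shift^[2 * l] (shift^[l ^ 2] ξ)) - r (c l)) := by
      rw [add_smul, one_smul]; abel
    rw [e]
    refine norm_add₃_le.trans ?_
    have h5 := norm_sub_le (φ (shift^[2 * l] (shift^[l ^ 2] ξ))) (r (c l))
    linarith
  refine ⟨C₁ + C₃ + M, fun m => ?_⟩
  induction m with
  | zero => simp
  | succ m ih =>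
    have e : (m + 1) ^ 2 = m ^ 2 + (2 * m + 1) := by ring
    rw [e, birkhoffSum_add, Finset.sum_range_succ, add_sub_add_comm]
    refine (norm_add_le _ _).trans ((add_le_add ih (hblock m)).trans (le_of_eq ?_))
    push_cast
    ring

/-- The pointwise rotation set of a uniformly continuous observable is convex: a sequence that
follows the orbits of `ξ` and `η` on longer and longer blocks, chosen greedily, realizes any
given point of the segment between their rotation vectors. -/
theorem IsUniformlyLocal.convex_pointwiseRotationSet (hφ : IsUniformlyLocal φ) (hs : 3 ≤ s) {M : ℝ}
    (hM : ∀ ξ, ‖φ ξ‖ ≤ M) : Convex ℝ (pointwiseRotationSet φ) := by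
  rintro x ⟨ξ₁, h₁⟩ y ⟨ξ₂, h₂⟩ a b ha hb hab
  set ρ := a • x + b • y with hρ
  let η : Bool → SymbolSpace s := fun t => if t then ξ₁ else ξ₂
  let r : Bool → EuclideanSpace ℝ (Fin N) := fun t => if t then x else y
  have hr : ∀ t, IsRotationVector φ (η t) (r t) := by
    rintro (_ | _)
    exacts [h₂, h₁]
  obtain ⟨B, hB⟩ := (Set.finite_range fun t => ‖r t - ρ‖).bddAbove
  have hB' : ∀ t, ‖r t - ρ‖ ≤ B := fun t => hB (mem_range_self t)
  have hB0 : 0 ≤ B := (norm_nonneg _).trans (hB' true)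
  have hsep : ∀ D, ∃ t, inner ℝ D (r t - ρ) ≤ 0 := by
    intro D
    by_contra! hcon
    have e : a • (r true - ρ) + b • (r false - ρ) = 0 := by
      have : a • (r true - ρ) + b • (r false - ρ) = ρ - (a + b) • ρ := by
        simp only [r, hρ]
        simp only [if_true, Bool.false_eq_true, if_false]
        module
      rw [this, hab, one_smul, sub_self]
    have e' := congrArg (inner ℝ D) e
    rw [inner_add_right, real_inner_smul_right, real_inner_smul_right, inner_zero_right] at e'
    have p1 := hcon true
    have p2 := hcon false
    rcases ha.eq_or_lt with rfl | ha'
    · have : b = 1 := by linarith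
      subst this
      linarith
    · nlinarith [mul_pos ha' p1, mul_nonneg hb p2.le]
  obtain ⟨c, hc⟩ := exists_seq_norm_sum_sq_le hB' hsep (w := fun l : ℕ => (2 * l + 1 : ℝ))
    fun l => by positivity
  obtain ⟨ξ, hξ⟩ := exists_concatenation hs fun l => η (c l)
  refine ⟨ξ, isRotationVector_iff.2 fun ε hε => ?_⟩
  have hM0 : 0 ≤ M := (norm_nonneg _).trans (hM ξ)
  obtain ⟨C, hC⟩ := hφ.norm_birkhoffSum_sq_sub_le hM hr hξ (show 0 < ε / 3 by positivity)
  have hsum : ∀ m : ℕ, ∑ l ∈ Finset.range m, (2 * l + 1 : ℝ) = m ^ 2 := by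
    intro m
    induction m with
    | zero => simp
    | succ m ih => rw [Finset.sum_range_succ, ih]; push_cast; ring
  -- The discrepancy of the greedy choice is `O(m ^ (3 / 2))`.
  have hD : ∀ m : ℕ, ‖∑ l ∈ Finset.range m, (2 * l + 1 : ℝ) • (r (c l) - ρ)‖ ≤
      ε / 3 * m ^ 2 + 3 * B ^ 2 / ε * m := by
    intro m
    refine (pow_le_pow_iff_left₀ (norm_nonneg _) (by positivity) two_ne_zero).1 ?_
    have h1 : ∑ l ∈ Finset.range m, ((2 * l + 1 : ℝ) * B) ^ 2 ≤ 4 * B ^ 2 * m ^ 3 := by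
      have : ∀ l ∈ Finset.range m, ((2 * l + 1 : ℝ) * B) ^ 2 ≤ (2 * m * B) ^ 2 := by
        intro l hl
        have hl' : (l : ℝ) + 1 ≤ m := by exact_mod_cast Finset.mem_range.1 hl
        gcongr
        linarith
      refine (Finset.sum_le_sum this).trans (le_of_eq ?_)
      rw [Finset.sum_const, Finset.card_range, nsmul_eq_mul]
      ring
    have h2 : (ε / 3 * (m : ℝ) ^ 2 + 3 * B ^ 2 / ε * m) ^ 2 - 4 * B ^ 2 * m ^ 3 =
        (ε / 3 * (m : ℝ) ^ 2 - 3 * B ^ 2 / ε * m) ^ 2 := by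
      field_simp
      ring
    have h3 := sq_nonneg (ε / 3 * (m : ℝ) ^ 2 - 3 * B ^ 2 / ε * m)
    linarith [hc m]
  set A := C + 3 * B ^ 2 / ε + 2 * (M + ‖ρ‖) with hA
  refine ⟨3 * A ^ 2 / (4 * ε), fun n => ?_⟩
  obtain ⟨m, j, hj, rfl⟩ : ∃ m j, j ≤ 2 * m ∧ n = m ^ 2 + j :=
    ⟨n.sqrt, n - n.sqrt * n.sqrt, by have := Nat.sqrt_le_add n; omega,
      by have := Nat.sqrt_le n; rw [sq]; omega⟩
  have hj' : (j : ℝ) ≤ 2 * m := by exact_mod_cast hj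
  have htail : ‖birkhoffSum shift φ j (shift^[m ^ 2] ξ) - (j : ℝ) • ρ‖ ≤ 2 * m * (M + ‖ρ‖) := by
    have h1 : ‖birkhoffSum shift φ j (shift^[m ^ 2] ξ)‖ ≤ j * M := by
      refine (norm_sum_le_of_le _ fun i _ => hM _).trans (le_of_eq ?_)
      rw [Finset.sum_const, Finset.card_range, nsmul_eq_mul]
    refine (norm_sub_le _ _).trans ?_
    rw [norm_smul, Real.norm_natCast]
    nlinarith [norm_nonneg ρ]
  have e : birkhoffSum shift φ (m ^ 2 + j) ξ - ((m ^ 2 + j : ℕ) : ℝ) • ρ =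
      (birkhoffSum shift φ (m ^ 2) ξ - ∑ l ∈ Finset.range m, (2 * l + 1 : ℝ) • r (c l)) +
      (∑ l ∈ Finset.range m, (2 * l + 1 : ℝ) • (r (c l) - ρ)) +
      (birkhoffSum shift φ j (shift^[m ^ 2] ξ) - (j : ℝ) • ρ) := by
    simp only [smul_sub, Finset.sum_sub_distrib, ← Finset.sum_smul, hsum]
    rw [birkhoffSum_add]
    push_cast
    rw [add_smul]
    abel
  rw [e]
  refine norm_add₃_le.trans ?_
  have hAM : A * m ≤ ε / 3 * m ^ 2 + 3 * A ^ 2 / (4 * ε) := by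
    have : ε / 3 * (m : ℝ) ^ 2 + 3 * A ^ 2 / (4 * ε) - A * m =
        ε / 3 * (m - 3 * A / (2 * ε)) ^ 2 := by
      field_simp
      ring
    have : 0 ≤ ε / 3 * (m - 3 * A / (2 * ε)) ^ 2 := by positivity
    linarith
  have hj0 : 0 ≤ ε * j := by positivity
  push_cast
  have := hC m
  have := hD m
  rw [hA] at hAM ⊢
  linarith

/-- Rotation vectors are approximated by those of periodic sequences, namely of the sequences that
repeat a long initial word. -/
theorem IsUniformlyLocal.pointwiseRotationSet_subset (hφ : IsUniformlyLocal φ) (hs : 3 ≤ s) {M : ℝ}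
    (hM : ∀ ξ, ‖φ ξ‖ ≤ M) : pointwiseRotationSet φ ⊆ closure (periodicRotationHull φ) := by
  rintro ρ ⟨ξ, hξ⟩
  refine Metric.mem_closure_iff.2 fun ε hε => ?_
  obtain ⟨C₁, hC₁⟩ := hφ.norm_birkhoffSum_sub_le hM (show 0 < ε / 4 by positivity)
  obtain ⟨C₂, hC₂⟩ := isRotationVector_iff.1 hξ (ε / 4) (by positivity)
  obtain ⟨n₀, hn₀⟩ := exists_nat_gt (2 * (C₁ + C₂ + M + ‖ρ‖) / ε)
  rw [div_lt_iff₀ hε] at hn₀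
  set n := n₀ + 1 with hn
  obtain ⟨η, hper, hag⟩ := exists_isPeriodicPt_eq hs ξ (show 0 < n by omega)
  refine ⟨_, subset_convexHull ℝ _ ⟨η, ⟨n + 1, Nat.succ_pos n, hper⟩,
    isRotationVector_of_isPeriodicPt (Nat.succ_pos n) hper⟩, ?_⟩
  have hpos : (0 : ℝ) < (n + 1 : ℕ) := by positivity
  have e : ρ - ((n + 1 : ℕ) : ℝ)⁻¹ • birkhoffSum shift φ (n + 1) η = ((n + 1 : ℕ) : ℝ)⁻¹ •
      ((birkhoffSum shift φ n ξ - birkhoffSum shift φ n η) +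
        (ρ - φ (shift^[n] η)) - (birkhoffSum shift φ n ξ - (n : ℝ) • ρ)) := by
    rw [eq_inv_smul_iff₀ hpos.ne', smul_sub, smul_inv_smul₀ hpos.ne', birkhoffSum_succ]
    push_cast
    rw [add_smul, one_smul]
    abel
  rw [dist_eq_norm, e, norm_smul, norm_inv, Real.norm_of_nonneg hpos.le, inv_mul_lt_iff₀ hpos]
  refine (norm_sub_le _ _).trans_lt ?_
  have h1 := norm_add_le (birkhoffSum shift φ n ξ - birkhoffSum shift φ n η) (ρ - φ (shift^[n] η))
  have h2 := hC₁ n ξ η hag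
  have h3 := hC₂ n
  have h4 := norm_sub_le ρ (φ (shift^[n] η))
  have h5 := hM (shift^[n] η)
  rw [hn] at *
  push_cast at *
  nlinarith

end Symbolic

/-! ### Rotation sets of open billiards -/

theorem IsOpenBilliard.isUniformlyLocal_startingPoint {N s : ℕ}
    {K : Fin s → Set (EuclideanSpace ℝ (Fin N))} (hK : IsOpenBilliard K) :
    IsUniformlyLocal (startingPoint K) := by
  intro ε hε
  obtain ⟨k, hk⟩ := hK.exists_norm_sub_lt hε
  refine ⟨k, fun ξ η h => ?_⟩
  obtain ⟨q, hq⟩ := hK.exists_isTrajectory ξ.1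
  obtain ⟨q', hq'⟩ := hK.exists_isTrajectory η.1
  rw [hK.startingPoint_eq hq, hK.startingPoint_eq hq', norm_sub_rev]
  exact (hk ξ η q q' hq hq' h).le

theorem theorem2 {N s : ℕ} (K : Fin s → Set (EuclideanSpace ℝ (Fin N)))
    (hK : IsOpenBilliard K) :
    (∀ ξ : SymbolSpace s, ∃! q, HasItinerary K ξ q) ∧
    Convex ℝ (closure (pointwiseRotationSet (startingPoint K))) ∧
    periodicRotationHull (startingPoint K) ⊆ pointwiseRotationSet (startingPoint K) ∧
    pointwiseRotationSet (startingPoint K) ⊆ closure (periodicRotationHull (startingPoint K)) := by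
  obtain ⟨M, hM⟩ := hK.exists_norm_startingPoint_le
  have hφ := hK.isUniformlyLocal_startingPoint
  have hJ := hφ.convex_pointwiseRotationSet hK.three_le_card hM
  refine ⟨hK.existsUnique_hasItinerary, hJ.closure, convexHull_min ?_ hJ,
    hφ.pointwiseRotationSet_subset hK.three_le_card hM⟩
  rintro ρ ⟨ξ, -, h⟩
  exact ⟨ξ, h⟩
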